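/- Let $X$ be a Tychonoff space and let $\mathcal I$ be an ideal of compact subsets of $X$, i.e. a non-empty family of compact subsets of $X$ such that $\bigcup\mathcal I=X$ and, for all $A,B\in\mathcal I$ and every compact $K\subseteq X$, $A\cup B\in\mathcal I$ and $A\cap K\in\mathcal I$. Let $Y\neq\{0\}$ be a metrizable locally convex space over $\mathbb R$ or $\mathbb C$. Let $C_{\mathcal I}(X,Y)$ be the set of all continuous functions $f:X\to Y$ with the $\mathcal I$-open topology, whose subbase consists of the sets $\{f: f(K)\subseteq U\}$ with $K\in\mathcal I$ and $U\subseteq Y$ open, and let $C^{b}_{\mathcal I}(X,Y)$ and $C^{rc}_{\mathcal I}(X,Y)$ be its subspaces of all $f$ such that $f(X)$ is bounded in $Y$, respectively relatively compact in $Y$. Let $E$ be any one of the spaces $C_{\mathcal I}(X,Y)$, $C^{b}_{\mathcal I}(X,Y)$, $C^{rc}_{\mathcal I}(X,Y)$. Then the following assertions are equivalent: (i) $E$ is a Fréchet–Urysohn space; (ii) $E$ is a sequential space; (iii) $E$ is a $k$-space (i.e. for each non-closed $A\subseteq E$ there is a compact $K\subseteq E$ such that $A\cap K$ is not closed in $K$);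 (iv) $X$ has the property $\gamma_{\mathcal I}$: whenever $\mathcal U$ is a family of open subsets of $X$ such that every $A\in\mathcal I$ is contained in some $U\in\mathcal U$, there is a sequence $(U_n)_{n\in\omega}$ of (not necessarily distinct) members of $\mathcal U$ such that for every $A\in\mathcal I$ there is $m\in\omega$ with $A\subseteq U_n$ for all $n\ge m$; (v) for some $\lambda\in(0,\omega]$ (that is, $\lambda\in\{1,2,3,\dots\}$ or $\lambda=\omega$), the power $E^\lambda$ with the product topology is Fréchet–Urysohn (respectively: sequential; a $k$-space); (vi) for every $\lambda\in(0,\omega]$, the power $E^\lambda$ is Fréchet–Urysohn (respectively: sequential; a $k$-space). Here each of (v) and (vi) stands for three assertions, one for each of the three properties, and all ten resulting assertions are equivalent. -/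

import Mathlib

open Set Topology

/-- An ideal of compact sets of `X`: a family of compact subsets that covers `X` and is closed
under finite unions (in particular it contains the empty union) and under intersections with
compact subsets of `X`. -/
structure CompactIdeal (X : Type*) [TopologicalSpace X] where
  /-- the members of the ideal -/
  sets : Set (Set X)
  isCompact : ∀ A ∈ sets, IsCompact A
  sUnion_eq : ⋃₀ sets = univ
  empty_mem : ∅ ∈ sets
  union_mem : ∀ A ∈ sets, ∀ B ∈ sets, A ∪ B ∈ sets
  inter_mem : ∀ A ∈ sets, ∀ K : Set X, IsCompact K → A ∩ K ∈ sets

namespace CompactIdeal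

variable {X : Type*} [TopologicalSpace X]

/-- `γ` is an `I`-cover of `X`: every member of `I` lies in some member of `γ`. -/
def IsCover (I : CompactIdeal X) (γ : Set (Set X)) : Prop :=
  ∀ A ∈ I.sets, ∃ U ∈ γ, A ⊆ U

/-- `C` is an `I`-sequence in `X`: every member of `I` lies in `C n` for all large `n`. -/
def IsSeq (I : CompactIdeal X) (C : ℕ → Set X) : Prop :=
  ∀ A ∈ I.sets, ∃ m : ℕ, ∀ n ≥ m, A ⊆ C n

/-- The property `γ_I` of `X`: every open `I`-cover contains an `I`-sequence. -/
def PropertyGamma (I : CompactIdeal X) : Prop :=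
  ∀ γ : Set (Set X), (∀ U ∈ γ, IsOpen U) → I.IsCover γ →
    ∃ C : ℕ → Set X, (∀ n, C n ∈ γ) ∧ I.IsSeq C

/-- The set underlying `C_I(X, Y)`: all continuous functions from `X` to `Y`. This copy of
`C(X, Y)` carries the `I`-open topology instead of the compact-open one. -/
def FunSpace (_I : CompactIdeal X) (Y : Type*) [TopologicalSpace Y] : Type _ := C(X, Y)

section FunSpace

variable (I : CompactIdeal X) (Y : Type*) [TopologicalSpace Y]

instance : FunLike (I.FunSpace Y) X Y := inferInstanceAs (FunLike C(X, Y) X Y)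

/-- The `I`-open topology, with the subbase of all sets `{f | f(K) ⊆ U}`, `K ∈ I`, `U` open. -/
instance : TopologicalSpace (I.FunSpace Y) :=
  .generateFrom (image2 (fun (K : Set X) (U : Set Y) => {f : I.FunSpace Y | MapsTo f K U})
    I.sets {U | IsOpen U})

/-- `C^b_I(X, Y)`, as a subset of `C_I(X, Y)`: the functions with (von Neumann) bounded image. -/
def boundedFun (𝕜 : Type*) [RCLike 𝕜] [AddCommGroup Y] [Module 𝕜 Y] : Set (I.FunSpace Y) :=
  {f | Bornology.IsVonNBounded 𝕜 (range f)}

/-- `C^{rc}_I(X, Y)`, as a subset of `C_I(X, Y)`: the functions with relatively compact image. -/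
def relCompactFun : Set (I.FunSpace Y) :=
  {f | IsCompact (closure (range f))}

end FunSpace

end CompactIdeal

/-- The power `E^l` for `l ∈ [0, ω]`, with the product topology: the elements of `ℕ∞` are the
ordinals up to `ω`, and each of them is indexed by the natural numbers below it. -/
abbrev CountablePower (E : Type*) (l : ℕ∞) : Type _ := {n : ℕ // (n : ℕ∞) < l} → E

/-! ### Bands and the `I`-open topology. -/

namespace CompactIdeal

variable {X : Type*} [TopologicalSpace X]

/-! The hard implication leads from the `k`-property to `γ_I`. Fix a nonzero real functional `u` on
`Y`. Cut-off functions show that `0` is a limit of functions in `E` that vanish on a given member of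
`I` and have `|u|` large off a neighbourhood of it (`Separates`). When a suitable set of such
functions is not closed, the `k`-property supplies a compact `K ⊆ E`, and on each member of `I` the
functions `u ∘ f`, `f ∈ K`, are uniformly bounded. For a countable open cover this bound singles out
an `I`-sequence (`Separates.exists_isSeq_of_countable`). An arbitrary open cover has a countable
subcover (`Separates.countablyCovered_univ`). Otherwise there is an `ω₁`-chain of members of `I`,
paired with functions from one compact set. By `exists_isOpen_finite_of_chain` each member of `I`
has a neighbourhood containing only finitely many members of the chain, so by
`Separates.countable_of_finite` the chain is countable, a contradiction. Conversely, `γ_I` applied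
to the sets where finitely many coordinates are close to a limit point gives convergent sequences in
every countable power. Since `E` is a quotient of each nonempty power, the assertions about powers
fall into the same circle. -/

/-- The band of points at which the function `u` has absolute value below `r`. -/
def band {Y : Type*} (u : Y → ℝ) (r : ℝ) : Set Y := {y | |u y| < r}

theorem isOpen_band {Y : Type*} [TopologicalSpace Y] {u : Y → ℝ} (hu : Continuous u) (r : ℝ) :
    IsOpen (band u r) :=
  isOpen_lt hu.abs continuous_const

theorem band_mono {Y : Type*} (u : Y → ℝ) {r s : ℝ} (h : r ≤ s) : band u r ⊆ band u s :=
  fun _ hy => lt_of_lt_of_le hy h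

variable {I : CompactIdeal X}

theorem singleton_mem (x : X) : {x} ∈ I.sets := by
  have hx : x ∈ ⋃₀ I.sets := I.sUnion_eq ▸ mem_univ x
  obtain ⟨A, hA, hxA⟩ := hx
  have := I.inter_mem A hA {x} isCompact_singleton
  rwa [inter_eq_right.2 (singleton_subset_iff.2 hxA)] at this

theorem inter_closed_mem {A : Set X} (hA : A ∈ I.sets) {Z : Set X} (hZ : IsClosed Z) :
    A ∩ Z ∈ I.sets := by
  have := I.inter_mem A hA (A ∩ Z) ((I.isCompact A hA).inter_right hZ)
  rwa [← inter_assoc, inter_self] at this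

section Topology

variable {Y : Type*} [TopologicalSpace Y] {E : Set (I.FunSpace Y)}

theorem continuous_coe (f : I.FunSpace Y) : Continuous f :=
  ContinuousMap.continuous (show C(X, Y) from f)

theorem isOpen_mapsTo {K : Set X} (hK : K ∈ I.sets) {U : Set Y} (hU : IsOpen U) :
    IsOpen {f : E | MapsTo f.1 K U} := by
  have : IsOpen {f : I.FunSpace Y | MapsTo f K U} :=
    TopologicalSpace.isOpen_generateFrom_of_mem ⟨K, hK, U, hU, rfl⟩
  exact this.preimage continuous_subtype_val

theorem isOpen_apply_mem (x : X) {U : Set Y} (hU : IsOpen U) :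
    IsOpen {f : E | f.1 x ∈ U} := by
  simpa [MapsTo] using isOpen_mapsTo (E := E) (singleton_mem (I := I) x) hU

theorem continuous_eval (x : X) : Continuous fun f : E => f.1 x :=
  continuous_def.2 fun _ hU => isOpen_apply_mem x hU

/-- A basic neighbourhood of `f` restricts values on finitely many members of `I` only, and their
union is again in `I`. -/
theorem mem_closure_of_eqOn {S : Set E} {f : E}
    (h : ∀ B ∈ I.sets, ∃ g ∈ S, EqOn g.1 f.1 B) : f ∈ closure S := by
  rw [mem_closure_iff_nhds]
  intro t ht
  have key : ∀ s ∈ 𝓝 f.1, ∃ B ∈ I.sets, ∀ g : I.FunSpace Y, EqOn g f.1 B → g ∈ s := by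
    intro s hs
    have hs' : s ∈ ⨅ v ∈ {v | f.1 ∈ v ∧ v ∈ image2 (fun (K : Set X) (U : Set Y) =>
        {f : I.FunSpace Y | MapsTo f K U}) I.sets {U | IsOpen U}}, Filter.principal v := by
      rw [← TopologicalSpace.nhds_generateFrom]; exact hs
    rw [iInf_subtype'] at hs'
    obtain ⟨F, hF, V, hV, rfl⟩ := Filter.mem_iInf.1 hs'
    have hW : ∀ i : F, ∃ B ∈ I.sets, ∀ g : I.FunSpace Y, EqOn g f.1 B → g ∈ V i := by
      rintro ⟨⟨v, hfv, K, hK, U, hU, rfl⟩, hi⟩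
      refine ⟨K, hK, fun g hg => hV _ ?_⟩
      intro x hx
      rw [hg hx]
      exact hfv hx
    choose B hB hBV using hW
    have := hF.to_subtype
    cases nonempty_fintype F
    have hun : ∀ G : Finset F, (⋃ i ∈ G, B i) ∈ I.sets := by
      classical
      intro G
      induction G using Finset.induction_on with
      | empty => simpa using I.empty_mem
      | insert a G _ ih =>
        rw [Finset.set_biUnion_insert]
        exact I.union_mem _ (hB a) _ ih
    refine ⟨_, hun Finset.univ, fun g hg => mem_iInter.2 fun i => hBV i g (hg.mono ?_)⟩
    exact subset_biUnion_of_mem (u := B) (Finset.mem_univ i)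
  obtain ⟨s, hs, hst⟩ := mem_nhds_subtype _ _ _ |>.1 ht
  obtain ⟨B, hB, hBs⟩ := key s hs
  obtain ⟨g, hgS, hg⟩ := h B hB
  exact ⟨g, hst (hBs _ hg), hgS⟩

theorem exists_mapsTo_band {u : Y → ℝ} (hu : Continuous u) {K : Set E} (hK : IsCompact K)
    {A : Set X} (hA : A ∈ I.sets) : ∃ n : ℕ, ∀ f ∈ K, MapsTo f.1 A (band u n) := by
  obtain ⟨n, hn⟩ := hK.elim_directed_cover (fun n : ℕ => {f : E | MapsTo f.1 A (band u n)})
    (fun n => isOpen_mapsTo hA (isOpen_band hu n)) (by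
      intro f _
      obtain ⟨b, hb⟩ := ((I.isCompact A hA).image
        (hu.abs.comp (continuous_coe f.1))).bddAbove
      obtain ⟨n, hn⟩ := exists_nat_gt b
      exact mem_iUnion.2 ⟨n, fun x hx => lt_of_le_of_lt (hb ⟨x, hx, rfl⟩) hn⟩)
    (directed_of_isDirected_le fun m n hmn f hf x hx =>
      band_mono u (Nat.cast_le.2 hmn) (hf hx))
  exact ⟨n, hn⟩

/-- This is how a compact subset of the function space produces an `I`-sequence. -/
theorem exists_forall_ge_subset {u : Y → ℝ} (hu : Continuous u) {K : Set E} (hK : IsCompact K)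
    {A : Set X} (hA : A ∈ I.sets) :
    ∃ m : ℕ, ∀ n ≥ m, A ⊆ {x | ∀ f ∈ K, |u (f.1 x)| < n} := by
  obtain ⟨m, hm⟩ := exists_mapsTo_band hu hK hA
  refine ⟨m, fun n hn x hx f hf => ?_⟩
  exact band_mono u (Nat.cast_le.2 hn) (hm f hf hx)

end Topology

end CompactIdeal

/-! ### Compact witnesses in `k`-spaces, and recursion of length `ω₁`. -/

/-- In a compactly coherent space, a point that lies in the closure of a sequence of closed sets
but in none of them yields a compact set that meets infinitely many of them. -/
theorem CompactlyCoherentSpace.exists_isCompact_frequently_inter {Z : Type*} [TopologicalSpace Z]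
    [CompactlyCoherentSpace Z] {S : ℕ → Set Z} (hS : ∀ n, IsClosed (S n)) {z : Z}
    (hz : z ∈ closure (⋃ n, S n)) (hz' : ∀ n, z ∉ S n) :
    ∃ K, IsCompact K ∧ ∀ N, ∃ n ≥ N, (K ∩ S n).Nonempty := by
  by_contra! hcon
  have : IsClosed (⋃ n, S n) := by
    rw [CompactlyCoherentSpace.isClosed_iff]
    intro K hK
    obtain ⟨N, hN⟩ := hcon K hK
    have : (Subtype.val ⁻¹' (⋃ n, S n) : Set K) = Subtype.val ⁻¹' (⋃ n ∈ Finset.range N, S n) := by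
      ext ⟨x, hx⟩
      simp only [mem_preimage, mem_iUnion, Finset.mem_range, exists_prop]
      refine ⟨fun ⟨n, hn⟩ => ⟨n, ?_, hn⟩, fun ⟨n, _, hn⟩ => ⟨n, hn⟩⟩
      by_contra! hNn
      exact (hN n hNn).subset ⟨hx, hn⟩
    rw [this]
    exact (isClosed_biUnion_finset fun n _ => hS n).preimage continuous_subtype_val
  rw [this.closure_eq] at hz
  obtain ⟨n, hn⟩ := mem_iUnion.1 hz
  exact hz' n hn

/-- In a compactly coherent space, a set that is not closed has a limit point of its trace on some
compact set that it misses. -/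
theorem CompactlyCoherentSpace.exists_isCompact_mem_closure {Z : Type*} [TopologicalSpace Z]
    [CompactlyCoherentSpace Z] {T : Set Z} (hT : ¬ IsClosed T) :
    ∃ K, IsCompact K ∧ ∃ z ∈ K, z ∈ closure (K ∩ T) ∧ z ∉ T := by
  rw [CompactlyCoherentSpace.isClosed_iff] at hT
  push Not at hT
  obtain ⟨K, hK, hKT⟩ := hT
  rw [← closure_subset_iff_isClosed, not_subset] at hKT
  obtain ⟨⟨z, hzK⟩, hz, hzT⟩ := hKT
  refine ⟨K, hK, z, hzK, ?_, hzT⟩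
  rw [closure_subtype] at hz
  simpa [Subtype.image_preimage_coe] using hz

/-- Transfinite recursion of length `ω₁`, where each step depends on countably many choices. -/
theorem exists_omega_one_chain {D : Type*} (P : Set D → D → Prop)
    (hP : ∀ s : Set D, s.Countable → ∃ d, P s d) :
    ∃ F : Iio (Ordinal.omega.{0} 1) → D, ∀ a, P (F '' Iio a) (F a) := by
  classical
  have hc : ∀ a : Iio (Ordinal.omega.{0} 1), (Iio a).Countable := by
    intro a
    have h1 : (Iio a.1).Countable := by
      rw [← Cardinal.le_aleph0_iff_set_countable, Cardinal.mk_Iio_ordinal,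
        Cardinal.lift_le_aleph0, ← Cardinal.lt_aleph_one_iff, ← Cardinal.lt_ord]
      rw [Cardinal.ord_aleph]
      exact a.2
    exact (h1.preimage Subtype.val_injective).mono fun b hb => hb
  obtain ⟨d₀, -⟩ := hP ∅ countable_empty
  let G : Set D → D := fun s => if h : ∃ d, P s d then h.choose else d₀
  have hG : ∀ s : Set D, s.Countable → P s (G s) := fun s hs => by
    simp only [G, dif_pos (hP s hs)]
    exact (hP s hs).choose_spec
  have wf : WellFounded ((· < ·) : Iio (Ordinal.omega.{0} 1) → _ → Prop) := wellFounded_lt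
  let F : Iio (Ordinal.omega.{0} 1) → D :=
    wf.fix fun a ih => G (range fun b : Iio a => ih b.1 b.2)
  refine ⟨F, fun a => ?_⟩
  have : F a = G (F '' Iio a) := by
    rw [image_eq_range]
    exact wf.fix_eq _ a
  rw [this]
  exact hG _ ((hc a).image F)

theorem uncountable_Iio_omega_one : Uncountable (Iio (Ordinal.omega.{0} 1)) := by
  rw [← Cardinal.aleph0_lt_mk_iff, Cardinal.mk_Iio_ordinal]
  simp

/-! ### From the `k`-property to `γ_I`. -/

namespace CompactIdeal

variable {X : Type*} [TopologicalSpace X] {I : CompactIdeal X}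
  {Y : Type*} [TopologicalSpace Y] {E : Set (I.FunSpace Y)}

/-- `u` vanishes along `f₀ ∈ E`, and `E` contains functions that agree with `f₀` on a given
member of the ideal and along which `|u|` is large outside a given neighbourhood of it. -/
structure Separates (u : Y → ℝ) (f₀ : E) : Prop where
  continuous : Continuous u
  apply_eq_zero : ∀ x, u (f₀.1 x) = 0
  exists_eqOn : ∀ B ∈ I.sets, ∀ V, IsOpen V → B ⊆ V → ∀ n : ℕ,
    ∃ h : E, EqOn h.1 f₀.1 B ∧ ∀ x ∉ V, n ≤ |u (h.1 x)|

variable {u : Y → ℝ} {f₀ : E}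

theorem Separates.exists_isSeq_of_countable [CompactlyCoherentSpace E] (hu : Separates u f₀)
    {U : ℕ → Set X} (hUo : ∀ k, IsOpen (U k)) (hU : I.IsCover (range U)) :
    ∃ C : ℕ → Set X, (∀ n, C n ∈ range U) ∧ I.IsSeq C := by
  by_cases hX : ∃ k, U k = univ
  · obtain ⟨k, hk⟩ := hX
    exact ⟨fun _ => U k, fun _ => ⟨k, rfl⟩, fun A _ => ⟨0, fun n _ => by simp [hk]⟩⟩
  push Not at hX
  -- Finiteness of the union keeps `S n` closed. The one parameter `n` bounds both the index and the
  -- height, so meeting `S n` for large `n` forces large values of `|u|` off some `U k`.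
  let S : ℕ → Set E := fun n => ⋃ k ∈ Finset.range n, {f | ∀ x ∉ U k, (n : ℝ) ≤ |u (f.1 x)|}
  have hS : ∀ n, IsClosed (S n) := by
    refine fun n => isClosed_biUnion_finset fun k _ => ?_
    simp only [ofPred_forall]
    refine isClosed_iInter fun x => isClosed_iInter fun _ => ?_
    exact isClosed_le continuous_const (hu.continuous.comp (continuous_eval x)).abs
  obtain ⟨K, hK, hKS⟩ := CompactlyCoherentSpace.exists_isCompact_frequently_inter hS (z := f₀)
    (by
      refine mem_closure_of_eqOn fun B hB => ?_
      obtain ⟨_, ⟨k, rfl⟩, hk⟩ := hU B hB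
      -- `S (k + 1)` is the first of these sets that admits the index `k`.
      obtain ⟨h, hh, hh'⟩ := hu.exists_eqOn B hB (U k) (hUo k) hk (k + 1)
      refine ⟨h, mem_iUnion.2 ⟨k + 1, ?_⟩, hh⟩
      exact mem_biUnion (Finset.mem_coe.2 (Finset.self_mem_range_succ k)) hh')
    (by
      intro n hn
      obtain ⟨k, hk, hf⟩ := mem_iUnion₂.1 hn
      obtain ⟨x, hx⟩ := (ne_univ_iff_exists_notMem _).1 (hX k)
      have := hf x hx
      rw [hu.apply_eq_zero, abs_zero] at this
      have hn0 : (n : ℝ) > 0 := by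
        exact_mod_cast lt_of_le_of_lt (Nat.zero_le k) (Finset.mem_range.1 hk)
      linarith)
  choose n hn f hf using hKS
  have : ∀ j, ∃ k, ∀ x ∉ U k, (n j : ℝ) ≤ |u ((f j).1 x)| := by
    intro j
    obtain ⟨k, _, hk⟩ := mem_iUnion₂.1 (hf j).2
    exact ⟨k, hk⟩
  choose k hk using this
  refine ⟨fun j => U (k j), fun j => ⟨k j, rfl⟩, fun A hA => ?_⟩
  obtain ⟨m, hm⟩ := exists_forall_ge_subset hu.continuous hK hA
  refine ⟨m, fun j hj x hx => ?_⟩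
  by_contra hxU
  exact absurd (hk j x hxU) (not_le.2 (hm (n j) (hj.trans (hn j)) hx _ (hf j).1))

/-- If there were infinitely many indices, `f₀` would be a limit of functions small on only finitely
many `A i`, without being one. The resulting compact `K` is uniformly bounded on each `A i`, while
each bound `n j` serves at most `n j` indices. -/
theorem Separates.countable_of_finite [CompactlyCoherentSpace E] (hu : Separates u f₀)
    {ι : Type*} {A : ι → Set X} (hA : ∀ i, A i ∈ I.sets)
    (hfin : ∀ B ∈ I.sets, ∃ V, IsOpen V ∧ B ⊆ V ∧ {i | A i ⊆ V}.Finite) : Countable ι := by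
  by_contra hι
  rw [not_countable_iff] at hι
  let S : ℕ → Set E := fun n =>
    {f | ∀ F : Finset ι, (∀ i ∈ F, MapsTo f.1 (A i) (band u (n + 1))) → F.card ≤ n}
  have hS : ∀ n, IsClosed (S n) := by
    intro n
    have : S n = ⋂ F : {F : Finset ι // n < F.card},
        (⋂ i ∈ F.1, {f : E | MapsTo f.1 (A i) (band u (n + 1))})ᶜ := by
      ext f
      simp only [S, mem_ofPred_eq, mem_iInter, mem_compl_iff, Subtype.forall]
      refine forall_congr' fun F => ?_
      rw [← not_lt, ← imp_not_comm]
    rw [this]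
    exact isClosed_iInter fun F => (isOpen_biInter_finset fun i _ =>
      isOpen_mapsTo (hA i) (isOpen_band hu.continuous _)).isClosed_compl
  obtain ⟨K, hK, hKS⟩ := CompactlyCoherentSpace.exists_isCompact_frequently_inter hS (z := f₀)
    (by
      refine mem_closure_of_eqOn fun B hB => ?_
      obtain ⟨V, hV, hBV, hVfin⟩ := hfin B hB
      obtain ⟨h, hh, hh'⟩ := hu.exists_eqOn B hB V hV hBV (hVfin.toFinset.card + 1)
      refine ⟨h, mem_iUnion.2 ⟨hVfin.toFinset.card, fun F hF => ?_⟩, hh⟩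
      refine Finset.card_le_card fun i hi => ?_
      rw [Finite.mem_toFinset]
      intro x hx
      by_contra hxV
      have h1 := hh' x hxV
      have h2 : |u (h.1 x)| < _ := hF i hi hx
      push_cast at h1
      linarith)
    (by
      intro n hn
      obtain ⟨F, hF⟩ := Infinite.exists_subset_card_eq ι (n + 1)
      have := hn F fun i _ x _ => by
        change |u (f₀.1 x)| < _
        rw [hu.apply_eq_zero, abs_zero]
        positivity
      omega)
  choose n hn f hf using hKS
  have hcov : (⋃ j, {i | A i ⊆ {x | ∀ g ∈ K, |u (g.1 x)| < n j}}) = univ := by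
    refine eq_univ_of_forall fun i => mem_iUnion.2 ?_
    obtain ⟨m, hm⟩ := exists_forall_ge_subset hu.continuous hK (hA i)
    exact ⟨m, hm _ (hn m)⟩
  have hct : (⋃ j, {i | A i ⊆ {x | ∀ g ∈ K, |u (g.1 x)| < n j}}).Countable := by
    refine countable_iUnion fun j => Finite.countable ?_
    by_contra hinf
    obtain ⟨F, hF, hFc⟩ := (show Set.Infinite _ from hinf).exists_subset_card_eq (n j + 1)
    have := (hf j).2 F fun i hi x hx => by
      have h1 := hF hi hx (f j) (hf j).1
      change |u ((f j).1 x)| < _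
      linarith
    omega
  rw [hcov, countable_univ_iff] at hct
  exact not_countable_iff.2 hι hct

/-- Along a well-ordered chain of members of `I` and functions from a compact set, each function
small on the earlier members but not on the later ones, every member of `I` has a neighbourhood
that contains only finitely many members of the chain. -/
theorem exists_isOpen_finite_of_chain (hu : Continuous u) {ι : Type*} [LinearOrder ι]
    [WellFoundedLT ι] {A : ι → Set X} {K : Set E} (hK : IsCompact K)
    {g : ι → E} (hgK : ∀ i, g i ∈ K) {c : ℝ} (hc : c < 1)
    (hlt : ∀ i j, i < j → ∀ x ∈ A i, |u ((g j).1 x)| ≤ c)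
    (hgt : ∀ i j, i < j → ¬ MapsTo (g i).1 (A j) (band u 1)) {B : Set X} (hB : B ∈ I.sets) :
    ∃ V, IsOpen V ∧ B ⊆ V ∧ {i | A i ⊆ V}.Finite := by
  by_contra! hcon
  -- `J` is a minimal initial segment on which every neighbourhood of `B` still contains infinitely
  -- many `A i`; by minimality such `i` are cofinal in `J`.
  have hJ : ∃ J : Set ι, (∀ V, IsOpen V → B ⊆ V → {i ∈ J | A i ⊆ V}.Infinite) ∧
      ∀ j ∈ J, ∃ V, IsOpen V ∧ B ⊆ V ∧ {i | i < j ∧ A i ⊆ V}.Finite := by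
    by_cases hne : {j : ι | ∀ V, IsOpen V → B ⊆ V → {i | i < j ∧ A i ⊆ V}.Infinite}.Nonempty
    · obtain ⟨j, hj, hmin⟩ := WellFounded.has_min (wellFounded_lt (α := ι)) _ hne
      refine ⟨Iio j, hj, fun i hi => ?_⟩
      by_contra! h
      exact hmin i h hi
    · refine ⟨univ, fun V hV hBV => by simpa using hcon V hV hBV, fun j _ => ?_⟩
      by_contra! h
      exact hne ⟨j, h⟩
  obtain ⟨J, hJinf, hJfin⟩ := hJ
  have hcof : ∀ j ∈ J, ∀ V, IsOpen V → B ⊆ V → ∃ i ∈ J, j < i ∧ A i ⊆ V := by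
    intro j hj V hV hBV
    obtain ⟨W, hW, hBW, hfin⟩ := hJfin j hj
    obtain ⟨i, ⟨hiJ, hi⟩, hi'⟩ := ((hJinf (V ∩ W) (hV.inter hW) (subset_inter hBV hBW)).sdiff
      (hfin.union (finite_singleton j))).nonempty
    refine ⟨i, hiJ, ?_, hi.trans inter_subset_left⟩
    by_contra! hle
    rcases hle.lt_or_eq with h | h
    · exact hi' (Or.inl ⟨h, hi.trans inter_subset_right⟩)
    · exact hi' (Or.inr h)
  have hne : Nonempty J := by
    obtain ⟨i, hi⟩ := (hJinf univ isOpen_univ (subset_univ _)).nonempty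
    exact ⟨⟨i, hi.1⟩⟩
  let p : Ultrafilter J := Ultrafilter.of Filter.atTop
  have hp : (p : Filter J) ≤ Filter.atTop := Ultrafilter.of_le _
  obtain ⟨h, -, hh⟩ := hK.ultrafilter_le_nhds (p.map fun j => g j)
    (Filter.le_principal_iff.2 (Filter.mem_map.2 (Filter.univ_mem' fun j => hgK j)))
  have hlim : Filter.Tendsto (fun j : J => g j) p (𝓝 h) := hh
  have hle : ∀ i ∈ J, ∀ x ∈ A i, |u (h.1 x)| ≤ c := by
    intro i hi x hx
    refine le_of_tendsto (((hu.comp (continuous_eval x)).abs.tendsto h).comp hlim) (hp ?_)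
    obtain ⟨i', hi', hii', -⟩ := hcof i hi univ isOpen_univ (subset_univ _)
    filter_upwards [Filter.eventually_ge_atTop (⟨i', hi'⟩ : J)] with j hj
    exact hlt i j (hii'.trans_le hj) x hx
  -- The limit `h` is at most `c` in size on every `A i` with `i ∈ J`, so all of these lie in `Z`.
  -- On `B ∩ Z` some `g j` is below `1`; the open set where `g j` is below `1`, together with `Zᶜ`,
  -- contains `B` and hence a later `A i`, contrary to `hgt`.
  let Z : Set X := {x | |u (h.1 x)| ≤ c}
  have hZ : IsClosed Z := isClosed_le (hu.comp (continuous_coe h.1)).abs continuous_const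
  have hmem := hlim ((isOpen_mapsTo (E := E) (inter_closed_mem hB hZ)
    (isOpen_band hu 1)).mem_nhds fun x hx => lt_of_le_of_lt hx.2 hc)
  obtain ⟨⟨j, hj⟩, hjm⟩ := p.nonempty_of_mem hmem
  have hjm : MapsTo (g j).1 (B ∩ Z) (band u 1) := hjm
  obtain ⟨i, hi, hji, hiV⟩ := hcof j hj ((g j).1 ⁻¹' band u 1 ∪ Zᶜ)
    (((isOpen_band hu 1).preimage (continuous_coe _)).union hZ.isOpen_compl)
    (fun x hx => or_iff_not_imp_right.2 fun hxZ => hjm ⟨hx, not_not.1 hxZ⟩)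
  refine hgt j i hji fun x hx => ?_
  exact (hiV hx).resolve_right fun hxZ => hxZ (hle i hi x hx)

/-- Countably many members of `γ` suffice to cover the members of `I` inside `B`. -/
def CountablyCovered (I : CompactIdeal X) (γ : Set (Set X)) (B : Set X) : Prop :=
  ∃ δ ⊆ γ, δ.Countable ∧ ∀ A ∈ I.sets, A ⊆ B → ∃ U ∈ δ, A ⊆ U

theorem CountablyCovered.of_iUnion {γ : Set (Set X)} {B : Set X} {C : ℕ → Set X}
    (hC : ∀ n, I.CountablyCovered γ (C n)) (h : ∀ A ∈ I.sets, A ⊆ B → ∃ n, A ⊆ C n) :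
    I.CountablyCovered γ B := by
  choose δ hδ hc hcov using hC
  refine ⟨⋃ n, δ n, iUnion_subset hδ, countable_iUnion hc, fun A hA hAB => ?_⟩
  obtain ⟨n, hn⟩ := h A hA hAB
  obtain ⟨U, hU, hAU⟩ := hcov n A hA hn
  exact ⟨U, mem_iUnion.2 ⟨n, hU⟩, hAU⟩

/-- The set `T` below has `f₀` in its closure, since one member of `γ` serves for each approximating
function. If the claim fails then `f₀ ∉ T`, and a limit `f ∉ T` of `K ∩ T` with `K` compact starts
the `ω₁`-chain. -/
theorem Separates.countablyCovered_univ [CompactlyCoherentSpace E] (hu : Separates u f₀)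
    {γ : Set (Set X)} (hγo : ∀ U ∈ γ, IsOpen U) (hγ : I.IsCover γ) :
    I.CountablyCovered γ univ := by
  by_contra hcon
  let T : Set E := {f | I.CountablyCovered γ (f.1 ⁻¹' band u 1)}
  have hT : ¬ IsClosed T := by
    intro hcl
    have h0 : f₀ ∈ T := by
      rw [← hcl.closure_eq]
      refine mem_closure_of_eqOn fun B hB => ?_
      obtain ⟨U, hU, hBU⟩ := hγ B hB
      obtain ⟨h, hh, hh'⟩ := hu.exists_eqOn B hB U (hγo U hU) hBU 1
      refine ⟨h, ⟨{U}, singleton_subset_iff.2 hU, countable_singleton U, fun A _ hAB =>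
        ⟨U, rfl, fun x hx => ?_⟩⟩, hh⟩
      by_contra hxU
      have h1 := hh' x hxU
      have h2 : |u (h.1 x)| < 1 := hAB hx
      push_cast at h1
      linarith
    refine hcon ?_
    obtain ⟨δ, h1, h2, h3⟩ := h0
    refine ⟨δ, h1, h2, fun A hA _ => h3 A hA fun x _ => ?_⟩
    change |u (f₀.1 x)| < 1
    rw [hu.apply_eq_zero, abs_zero]
    exact one_pos
  obtain ⟨K, hK, f, hfK, hfcl, hfT⟩ := CompactlyCoherentSpace.exists_isCompact_mem_closure hT
  -- By compactness, each member of `I` inside the open band of radius `1` lies in a smaller one; a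
  -- gap `c < 1` is needed because limits only preserve `≤ c`.
  obtain ⟨c, hc, hcf⟩ : ∃ c < 1, ¬ I.CountablyCovered γ (f.1 ⁻¹' band u c) := by
    by_contra! h
    refine hfT (CountablyCovered.of_iUnion
      (C := fun n : ℕ => f.1 ⁻¹' band u (1 - 1 / (n + 1))) (fun n => h _ ?_) fun A hA hAf => ?_)
    · have : (0 : ℝ) < 1 / (n + 1) := Nat.one_div_pos_of_nat
      linarith
    · rcases A.eq_empty_or_nonempty with rfl | hne
      · exact ⟨0, empty_subset _⟩
      obtain ⟨a, ha, hmax⟩ := (I.isCompact A hA).exists_isMaxOn hne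
        (hu.continuous.comp (continuous_coe f.1)).abs.continuousOn
      have ha1 : |u (f.1 a)| < 1 := hAf ha
      obtain ⟨n, hn⟩ := exists_nat_one_div_lt (sub_pos.2 ha1)
      refine ⟨n, fun x hx => ?_⟩
      have h1 : |u (f.1 x)| ≤ |u (f.1 a)| := hmax hx
      change |u (f.1 x)| < _
      linarith
  -- The requirement is conditional on the earlier pairs being good, which makes the recursion
  -- total; goodness of all pairs follows afterwards by induction.
  have hstep : ∀ s : Set (Set X × E), s.Countable → ∃ d : Set X × E,
      (∀ e ∈ s, e.1 ∈ I.sets ∧ e.2 ∈ K ∩ T ∧ e.1 ⊆ f.1 ⁻¹' band u c) →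
      (d.1 ∈ I.sets ∧ d.2 ∈ K ∩ T ∧ d.1 ⊆ f.1 ⁻¹' band u c) ∧
      ∀ e ∈ s, (∀ x ∈ e.1, |u (d.2.1 x)| ≤ c) ∧ ¬ MapsTo e.2.1 d.1 (band u 1) := by
    intro s hs
    by_cases hgood : ∀ e ∈ s, e.1 ∈ I.sets ∧ e.2 ∈ K ∩ T ∧ e.1 ⊆ f.1 ⁻¹' band u c
    swap
    · exact ⟨(∅, f), fun h => absurd h hgood⟩
    -- Otherwise the countably many countable subfamilies belonging to the earlier functions would
    -- together cover the members of `I` in the band of radius `c`.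
    have hA : ∃ A ∈ I.sets, A ⊆ f.1 ⁻¹' band u c ∧ ∀ e ∈ s, ¬ MapsTo e.2.1 A (band u 1) := by
      by_contra! h
      refine hcf ?_
      have hch : ∀ e : s, I.CountablyCovered γ (e.1.2.1 ⁻¹' band u 1) := fun e =>
        (hgood e.1 e.2).2.1.2
      choose δ hδ hδc hcov using hch
      have := hs.to_subtype
      refine ⟨⋃ e, δ e, iUnion_subset hδ, countable_iUnion hδc, fun A hA hAf => ?_⟩
      obtain ⟨e, he, hm⟩ := h A hA hAf
      obtain ⟨U, hU, hAU⟩ := hcov ⟨e, he⟩ A hA hm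
      exact ⟨U, mem_iUnion.2 ⟨_, hU⟩, hAU⟩
    obtain ⟨A, hAI, hAf, hAs⟩ := hA
    suffices ∃ g ∈ K ∩ T, ∀ e ∈ s, ∀ x ∈ e.1, |u (g.1 x)| ≤ c by
      obtain ⟨g, hg, hgs⟩ := this
      exact ⟨(A, g), fun _ => ⟨⟨hAI, hg, hAf⟩, fun e he => ⟨hgs e he, hAs e he⟩⟩⟩
    rcases s.eq_empty_or_nonempty with rfl | hne
    · obtain ⟨g, hg⟩ := closure_nonempty_iff.1 ⟨f, hfcl⟩
      exact ⟨g, hg, by simp⟩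
    obtain ⟨e, rfl⟩ := hs.exists_eq_range hne
    have hg : ∀ n, ∃ g ∈ K ∩ T, ∀ i ∈ Finset.range (n + 1), MapsTo g.1 (e i).1 (band u c) := by
      intro n
      obtain ⟨g, hg, hgKT⟩ := mem_closure_iff.1 hfcl
        (⋂ i ∈ Finset.range (n + 1), {g : E | MapsTo g.1 (e i).1 (band u c)})
        (isOpen_biInter_finset fun i _ =>
          isOpen_mapsTo (hgood _ ⟨i, rfl⟩).1 (isOpen_band hu.continuous c))
        (mem_iInter₂.2 fun i _ => (hgood _ ⟨i, rfl⟩).2.2)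
      exact ⟨g, hgKT, fun i hi => mem_iInter₂.1 hg i hi⟩
    choose g hgKT hg using hg
    let p : Ultrafilter ℕ := Ultrafilter.of Filter.atTop
    have hp : (p : Filter ℕ) ≤ Filter.atTop := Ultrafilter.of_le _
    obtain ⟨h, hhK, hh⟩ := hK.ultrafilter_le_nhds (p.map g)
      (Filter.le_principal_iff.2 (Filter.mem_map.2 (Filter.univ_mem' fun j => (hgKT j).1)))
    have hlim : Filter.Tendsto g p (𝓝 h) := hh
    -- The ultrafilter limit stays in `T`: a member of `I` on which `h` is below `1` is one on which
    -- some `g n` is below `1`, so countable covers for the `g n` suffice.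
    refine ⟨h, ⟨hhK, CountablyCovered.of_iUnion (fun n => (hgKT n).2) fun B hB hBh => ?_⟩, ?_⟩
    · exact p.nonempty_of_mem
        (hlim ((isOpen_mapsTo hB (isOpen_band hu.continuous 1)).mem_nhds hBh))
    · rintro _ ⟨i, rfl⟩ x hx
      refine le_of_tendsto
        (((hu.continuous.comp (continuous_eval x)).abs.tendsto h).comp hlim) (hp ?_)
      filter_upwards [Filter.eventually_ge_atTop i] with n hn
      have h1 : |u ((g n).1 x)| < c := hg n i (Finset.mem_range.2 (Nat.lt_succ_of_le hn)) hx
      exact h1.le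
  obtain ⟨F, hF⟩ := exists_omega_one_chain _ hstep
  have hgood : ∀ a, (F a).1 ∈ I.sets ∧ (F a).2 ∈ K ∩ T ∧ (F a).1 ⊆ f.1 ⁻¹' band u c := by
    intro a
    induction a using WellFoundedLT.induction with
    | ind a ih => exact (hF a (by rintro _ ⟨b, hb, rfl⟩; exact ih b hb)).1
  have hF' := fun a => (hF a (by rintro _ ⟨b, _, rfl⟩; exact hgood b)).2
  have := uncountable_Iio_omega_one
  exact not_countable (hu.countable_of_finite (fun a => (hgood a).1) fun B hB =>
    exists_isOpen_finite_of_chain hu.continuous hK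
      (fun a => (hgood a).2.1.1) hc
      (fun i j hij => (hF' j _ (mem_image_of_mem F hij)).1)
      (fun i j hij => (hF' j _ (mem_image_of_mem F hij)).2) hB)

theorem Separates.propertyGamma [CompactlyCoherentSpace E] (hu : Separates u f₀) :
    I.PropertyGamma := by
  intro γ hγo hγ
  obtain ⟨δ, hδγ, hδc, hδ⟩ := hu.countablyCovered_univ hγo hγ
  have hne : δ.Nonempty := by
    obtain ⟨U, hU, -⟩ := hδ ∅ I.empty_mem (empty_subset _)
    exact ⟨U, hU⟩
  obtain ⟨U, rfl⟩ := hδc.exists_eq_range hne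
  obtain ⟨C, hC, hseq⟩ := hu.exists_isSeq_of_countable (fun k => hγo _ (hδγ ⟨k, rfl⟩))
    fun A hA => hδ A hA (subset_univ A)
  exact ⟨C, fun n => hδγ (hC n), hseq⟩

end CompactIdeal

/-! ### Functional separation, quotients and powers. -/

/-- In a Tychonoff space, a compact set and a disjoint closed set are functionally separated. -/
theorem IsCompact.exists_continuous_zero_one_of_completelyRegular {X : Type*} [TopologicalSpace X]
    [CompletelyRegularSpace X] {B V : Set X} (hB : IsCompact B) (hV : IsOpen V) (hBV : B ⊆ V) :
    ∃ φ : X → ℝ, Continuous φ ∧ (∀ x ∈ B, φ x = 0) ∧ (∀ x ∉ V, φ x = 1) ∧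
      ∀ x, φ x ∈ Icc (0 : ℝ) 1 := by
  refine hB.induction_on (p := fun s => ∃ φ : X → ℝ, Continuous φ ∧ (∀ x ∈ s, φ x = 0) ∧
    (∀ x ∉ V, φ x = 1) ∧ ∀ x, φ x ∈ Icc (0 : ℝ) 1) ?_ ?_ ?_ ?_
  · exact ⟨fun _ => 1, continuous_const, by simp, by simp, by simp⟩
  · rintro s t hst ⟨φ, h1, h2, h3⟩
    exact ⟨φ, h1, fun x hx => h2 x (hst hx), h3⟩
  · rintro s t ⟨φ, h1, h2, h3, h4⟩ ⟨ψ, g1, g2, g3, g4⟩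
    refine ⟨fun x => φ x * ψ x, h1.mul g1, ?_, fun x hx => by simp [h3 x hx, g3 x hx],
      fun x => ⟨mul_nonneg (h4 x).1 (g4 x).1, mul_le_one₀ (h4 x).2 (g4 x).1 (g4 x).2⟩⟩
    rintro x (hx | hx)
    · simp [h2 x hx]
    · simp [g2 x hx]
  · intro x hx
    obtain ⟨f, hf, hfx, hfV⟩ := CompletelyRegularSpace.completely_regular x Vᶜ hV.isClosed_compl
      (not_not.2 (hBV hx))
    have hf' : Continuous fun z => (f z : ℝ) := continuous_subtype_val.comp hf
    refine ⟨{z | (f z : ℝ) < 1 / 2}, mem_nhdsWithin_of_mem_nhds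
      ((isOpen_lt hf' continuous_const).mem_nhds ?_), fun z => max (2 * (f z : ℝ) - 1) 0,
      by fun_prop, fun z hz => max_eq_right ?_, fun z hz => ?_, fun z => ⟨le_max_right _ _, ?_⟩⟩
    · simp [hfx]
    · have : (f z : ℝ) < 1 / 2 := hz
      linarith
    · simp only [hfV hz, Pi.one_apply, Icc.coe_one]
      norm_num
    · have := (f z).2.2
      exact max_le (by linarith) zero_le_one

theorem CompactlyCoherentSpace.of_isQuotientMap {Z W : Type*} [TopologicalSpace Z]
    [TopologicalSpace W] [CompactlyCoherentSpace Z] {q : Z → W} (hq : IsQuotientMap q) :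
    CompactlyCoherentSpace W := by
  refine CompactlyCoherentSpace.of_isOpen fun A hA => ?_
  rw [← hq.isOpen_preimage, CompactlyCoherentSpace.isOpen_iff]
  intro K hK
  have h := hA (q '' K) (hK.image hq.continuous)
  exact h.preimage (f := fun z : K => (⟨q z, mem_image_of_mem q z.2⟩ : q '' K))
    (Continuous.subtype_mk (hq.continuous.comp continuous_subtype_val) _)

section CountablePower

variable {E : Type*} [TopologicalSpace E] {l : ℕ∞}

theorem CountablePower.isQuotientMap_eval (hl : 0 < l) :
    IsQuotientMap fun s : CountablePower E l => s ⟨0, by exact_mod_cast hl⟩ :=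
  IsQuotientMap.of_inverse (f := fun (e : E) (_ : {n : ℕ // (n : ℕ∞) < l}) => e)
    (continuous_pi fun _ => continuous_id) (continuous_apply _) fun _ => rfl

theorem CountablePower.isInducing_const (hl : 0 < l) :
    IsInducing fun (e : E) (_ : {n : ℕ // (n : ℕ∞) < l}) => e :=
  IsInducing.of_comp (f := fun (e : E) (_ : {n : ℕ // (n : ℕ∞) < l}) => e)
    (g := fun s : CountablePower E l => s ⟨0, by exact_mod_cast hl⟩)
    (by fun_prop) (by fun_prop) IsInducing.id

end CountablePower

/-! ### From `γ_I` to Fréchet–Urysohn powers, and the separating functional. -/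

namespace CompactIdeal

variable {X : Type*} [TopologicalSpace X] {I : CompactIdeal X}

/-- As `I` contains the compact subsets of `A`, restriction to `A` is continuous into `C(A, Y)` with
the compact-open topology, which is that of uniform convergence. -/
theorem isOpen_forall_dist_lt {Y : Type*} [MetricSpace Y] {E : Set (I.FunSpace Y)} (f : E)
    {A : Set X} (hA : A ∈ I.sets) {ε : ℝ} (hε : 0 < ε) :
    {g : E | ∀ x ∈ A, dist (g.1 x) (f.1 x) < ε} ∈ 𝓝 f := by
  have := isCompact_iff_compactSpace.1 (I.isCompact A hA)
  let r : E → C(A, Y) := fun g => ⟨fun x => g.1 x, (continuous_coe g.1).comp continuous_subtype_val⟩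
  have hr : Continuous r := by
    rw [ContinuousMap.continuous_compactOpen]
    intro K hK U hU
    have hK' : Subtype.val '' K ∈ I.sets := by
      have h := I.inter_mem A hA _ (hK.image continuous_subtype_val)
      rwa [inter_eq_right.2 (Subtype.coe_image_subset A K)] at h
    convert isOpen_mapsTo (E := E) hK' hU using 3 with g
    simp [r, MapsTo]
  have hball := hr.continuousAt.preimage_mem_nhds (Metric.ball_mem_nhds (r f) hε)
  filter_upwards [hball] with g hg x hx
  exact (ContinuousMap.dist_lt_iff hε).1 hg ⟨x, hx⟩

theorem tendsto_of_forall_dist_lt {Y : Type*} [MetricSpace Y] {E : Set (I.FunSpace Y)} {f : E}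
    {s : ℕ → E} (h : ∀ A ∈ I.sets, ∀ ε > 0, ∀ᶠ k in Filter.atTop,
      ∀ x ∈ A, dist ((s k).1 x) (f.1 x) < ε) : Filter.Tendsto s Filter.atTop (𝓝 f) := by
  rw [tendsto_subtype_rng]
  refine TopologicalSpace.tendsto_nhds_generateFrom_iff.2 ?_
  rintro _ ⟨K, hK, U, hU, rfl⟩ hf
  obtain ⟨δ, hδ, hδU⟩ := ((I.isCompact K hK).image (continuous_coe f.1)).exists_thickening_subset_open
    hU (image_subset_iff.2 hf)
  filter_upwards [h K hK δ hδ] with k hk x hx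
  exact hδU (Metric.mem_thickening_iff.2 ⟨_, mem_image_of_mem _ hx, hk x hx⟩)

/-- Under `γ_I`, one can choose from each of countably many open `I`-covers so that infinitely
many of the choices (in the sense of indices tending to infinity) form an `I`-sequence. -/
theorem PropertyGamma.exists_isSeq [T1Space X] (hγ : I.PropertyGamma) {S : Type*} {U : ℕ → S → Set X}
    (hUo : ∀ n s, IsOpen (U n s)) (hU : ∀ n, ∀ A ∈ I.sets, ∃ s, A ⊆ U n s) :
    ∃ (n : ℕ → ℕ) (s : ℕ → S), Filter.Tendsto n Filter.atTop Filter.atTop ∧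
      I.IsSeq fun k => U (n k) (s k) := by
  by_cases hx : ∃ x : ℕ → X, ∀ A ∈ I.sets, ∃ n, x n ∉ A
  · obtain ⟨x, hx⟩ := hx
    -- Deleting `x n` from the sets of the `n`-th cover lets each index occur only finitely often,
    -- since an `I`-sequence eventually contains the point `x n`.
    obtain ⟨C, hC, hseq⟩ := hγ (range fun p : ℕ × S => U p.1 p.2 ∩ {x p.1}ᶜ)
      (by
        rintro _ ⟨p, rfl⟩
        exact (hUo _ _).inter isOpen_compl_singleton)
      (by
        intro A hA
        obtain ⟨n, hn⟩ := hx A hA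
        obtain ⟨s, hs⟩ := hU n A hA
        exact ⟨_, ⟨(n, s), rfl⟩, subset_inter hs (subset_compl_singleton_iff.2 hn)⟩)
    choose p hp using hC
    refine ⟨fun k => (p k).1, fun k => (p k).2, ?_, fun A hA => ?_⟩
    · rw [← Nat.cofinite_eq_atTop]
      refine Filter.Tendsto.cofinite_of_finite_preimage_singleton fun n => ?_
      obtain ⟨m, hm⟩ := hseq {x n} (singleton_mem _)
      refine (finite_lt_nat m).subset fun k (hk : (p k).1 = n) => ?_
      by_contra! hmk
      have h1 := hm k (not_lt.1 hmk) (mem_singleton (x n))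
      rw [← hp k] at h1
      exact h1.2 (by rw [hk]; rfl)
    · obtain ⟨m, hm⟩ := hseq A hA
      exact ⟨m, fun k hk => (hm k hk).trans (by rw [← hp k]; exact inter_subset_left)⟩
  · push Not at hx
    -- Here every sequence of points lies in a member of `I`. Points omitted by the terms of an
    -- `I`-sequence would lie in one such member, so each cover must contain `X` itself.
    have huniv : ∀ n, ∃ s, U n s = univ := by
      intro n
      by_contra! h
      choose y hy using fun s => (ne_univ_iff_exists_notMem _).1 (h s)
      obtain ⟨C, hC, hseq⟩ := hγ (range (U n)) (by rintro _ ⟨s, rfl⟩; exact hUo n s)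
        (fun A hA => (hU n A hA).elim fun s hs => ⟨_, ⟨s, rfl⟩, hs⟩)
      choose s hs using hC
      obtain ⟨A, hA, hyA⟩ := hx fun k => y (s k)
      obtain ⟨m, hm⟩ := hseq A hA
      have := hm m le_rfl (hyA m)
      rw [← hs m] at this
      exact hy _ this
    choose s hs using huniv
    exact ⟨id, s, Filter.tendsto_id, fun A _ => ⟨0, fun k _ => by simp [hs]⟩⟩

theorem PropertyGamma.frechetUrysohnSpace [T1Space X] (hγ : I.PropertyGamma) {Y : Type*} [TopologicalSpace Y]
    [TopologicalSpace.MetrizableSpace Y] (E : Set (I.FunSpace Y)) (l : ℕ∞) :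
    FrechetUrysohnSpace (CountablePower E l) := by
  let _ := TopologicalSpace.metrizableSpaceMetric Y
  refine ⟨fun S f hf => ?_⟩
  -- The index `n` controls both the number of coordinates and the precision, so `n k → ∞` gives
  -- convergence in the product.
  let U : ℕ → S → Set X := fun n s =>
    {x | ∀ i : {i : ℕ // (i : ℕ∞) < l}, i.1 < n →
      dist ((s.1 i).1 x) ((f i).1 x) < 1 / (n + 1 : ℝ)}
  have hfin : ∀ n : ℕ, {i : {i : ℕ // (i : ℕ∞) < l} | i.1 < n}.Finite := fun n =>
    (finite_lt_nat n).preimage Subtype.val_injective.injOn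
  have hpos : ∀ n : ℕ, (0 : ℝ) < 1 / (n + 1 : ℝ) := fun n => Nat.one_div_pos_of_nat
  obtain ⟨n, s, hn, hs⟩ := hγ.exists_isSeq (U := U)
    (by
      intro n s
      have : U n s = ⋂ i ∈ {i : {i : ℕ // (i : ℕ∞) < l} | i.1 < n},
          {x | dist ((s.1 i).1 x) ((f i).1 x) < 1 / (n + 1 : ℝ)} := by
        ext x
        simp [U]
      rw [this]
      exact (hfin n).isOpen_biInter fun i _ =>
        isOpen_lt ((continuous_coe _).dist (continuous_coe _)) continuous_const)
    (by
      intro n A hA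
      have hmem : (⋂ i ∈ {i : {i : ℕ // (i : ℕ∞) < l} | i.1 < n},
          {g : CountablePower E l | ∀ x ∈ A, dist ((g i).1 x) ((f i).1 x) < 1 / (n + 1 : ℝ)})
          ∈ 𝓝 f := by
        refine (Filter.biInter_mem (hfin n)).2 fun i _ => ?_
        exact (continuous_apply i).continuousAt.preimage_mem_nhds
          (isOpen_forall_dist_lt (f i) hA (hpos n))
      obtain ⟨g, hg, hgS⟩ := mem_closure_iff_nhds.1 hf _ hmem
      exact ⟨⟨g, hgS⟩, fun x hx i hi => mem_iInter₂.1 hg i hi x hx⟩)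
  refine ⟨fun k => (s k).1, fun k => (s k).2, tendsto_pi_nhds.2 fun i => ?_⟩
  refine tendsto_of_forall_dist_lt fun A hA ε hε => ?_
  obtain ⟨m, hm⟩ := hs A hA
  have hsmall : ∀ᶠ k in Filter.atTop, 1 / ((n k : ℝ) + 1) < ε :=
    (tendsto_one_div_add_atTop_nhds_zero_nat.comp hn).eventually (gt_mem_nhds hε)
  filter_upwards [Filter.eventually_ge_atTop m, hn.eventually_gt_atTop i.1, hsmall]
    with k hk hik hkε x hx
  exact (hm k hk hx i hik).trans hkε

/-- Hahn–Banach gives `u` with `u y > 0`, and the functions used are cut-offs times multiples of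
`y`. Their images lie in a compact segment, so they belong to all three spaces. -/
theorem exists_separates [CompletelyRegularSpace X] {𝕜 : Type*} [RCLike 𝕜]
    {Y : Type*} [AddCommGroup Y] [TopologicalSpace Y] [IsTopologicalAddGroup Y]
    [Module 𝕜 Y] [ContinuousSMul 𝕜 Y] [Module ℝ Y] [IsScalarTower ℝ 𝕜 Y]
    [LocallyConvexSpace ℝ Y] [T2Space Y] [Nontrivial Y] (E : Set (I.FunSpace Y))
    (hE : E = univ ∨ E = I.boundedFun Y 𝕜 ∨ E = I.relCompactFun Y) :
    ∃ (u : Y → ℝ) (f₀ : E), Separates u f₀ := by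
  have : ContinuousSMul ℝ Y := IsScalarTower.continuousSMul 𝕜
  have hmem : ∀ (f : I.FunSpace Y) (K : Set Y), IsCompact K → range f ⊆ K → f ∈ E := by
    intro f K hK hfK
    rcases hE with rfl | rfl | rfl
    · trivial
    · exact (hK.isVonNBounded 𝕜).subset hfK
    · exact hK.of_isClosed_subset isClosed_closure (closure_minimal hfK hK.isClosed)
  obtain ⟨y, hy⟩ := exists_ne (0 : Y)
  obtain ⟨u, hu⟩ := geometric_hahn_banach_point_point hy.symm
  rw [map_zero] at hu
  let f₀ : I.FunSpace Y := (ContinuousMap.const X 0 : C(X, Y))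
  refine ⟨u, ⟨f₀, hmem f₀ {0} isCompact_singleton ?_⟩, u.continuous, fun x => map_zero u, ?_⟩
  · rintro _ ⟨x, rfl⟩
    rfl
  intro B hB V hV hBV n
  obtain ⟨φ, hφ, hφB, hφV, hφI⟩ :=
    (I.isCompact B hB).exists_continuous_zero_one_of_completelyRegular hV hBV
  let σ : ℝ → Y := fun t => (t * (n / u y)) • y
  have hσ : Continuous σ := by fun_prop
  let h : I.FunSpace Y := (⟨fun x => σ (φ x), hσ.comp hφ⟩ : C(X, Y))
  refine ⟨⟨h, hmem h (σ '' Icc 0 1) (isCompact_Icc.image hσ) ?_⟩, fun x hx => ?_, fun x hx => ?_⟩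
  · rintro _ ⟨x, rfl⟩
    exact ⟨φ x, hφI x, rfl⟩
  · change (φ x * (n / u y)) • y = 0
    rw [hφB x hx, zero_mul, zero_smul]
  · change (n : ℝ) ≤ |u ((φ x * (n / u y)) • y)|
    rw [hφV x hx, one_mul, map_smul, smul_eq_mul, div_mul_cancel₀ _ hu.ne']
    exact le_abs_self _

end CompactIdeal

theorem theoremt {X : Type*} [TopologicalSpace X] [T35Space X] (I : CompactIdeal X)
    {𝕜 : Type*} [RCLike 𝕜]
    {Y : Type*} [AddCommGroup Y] [TopologicalSpace Y] [IsTopologicalAddGroup Y]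
    [Module 𝕜 Y] [ContinuousSMul 𝕜 Y] [Module ℝ Y] [IsScalarTower ℝ 𝕜 Y]
    [LocallyConvexSpace ℝ Y] [TopologicalSpace.MetrizableSpace Y] [Nontrivial Y]
    (E : Set (I.FunSpace Y))
    (hE : E = univ ∨ E = I.boundedFun Y 𝕜 ∨ E = I.relCompactFun Y) :
    List.TFAE [
      FrechetUrysohnSpace E,
      SequentialSpace E,
      CompactlyCoherentSpace E,
      I.PropertyGamma,
      ∃ l : ℕ∞, 0 < l ∧ FrechetUrysohnSpace (CountablePower E l),
      ∃ l : ℕ∞, 0 < l ∧ SequentialSpace (CountablePower E l),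
      ∃ l : ℕ∞, 0 < l ∧ CompactlyCoherentSpace (CountablePower E l),
      ∀ l : ℕ∞, 0 < l → FrechetUrysohnSpace (CountablePower E l),
      ∀ l : ℕ∞, 0 < l → SequentialSpace (CountablePower E l),
      ∀ l : ℕ∞, 0 < l → CompactlyCoherentSpace (CountablePower E l)] := by
  obtain ⟨u, f₀, hu⟩ := CompactIdeal.exists_separates E hE
  tfae_have 1 → 2 := fun _ => inferInstance
  tfae_have 2 → 3 := fun _ => inferInstance
  tfae_have 3 → 4 := fun _ => hu.propertyGamma
  tfae_have 4 → 8 := fun h l _ => h.frechetUrysohnSpace E l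
  tfae_have 8 → 9 := fun h l hl => have := h l hl; inferInstance
  tfae_have 9 → 10 := fun h l hl => have := h l hl; inferInstance
  tfae_have 10 → 7 := fun h => ⟨1, one_pos, h 1 one_pos⟩
  tfae_have 8 → 5 := fun h => ⟨1, one_pos, h 1 one_pos⟩
  tfae_have 5 → 6 := fun ⟨l, hl, _⟩ => ⟨l, hl, inferInstance⟩
  tfae_have 6 → 7 := fun ⟨l, hl, _⟩ => ⟨l, hl, inferInstance⟩
  tfae_have 7 → 3 := fun ⟨_, hl, _⟩ =>
    CompactlyCoherentSpace.of_isQuotientMap (CountablePower.isQuotientMap_eval hl)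
  tfae_have 8 → 1 := fun h =>
    have := h 1 one_pos
    (CountablePower.isInducing_const one_pos).frechetUrysohnSpace
  tfae_finish
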